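/- A uniform facility location instance $S=(\mathcal X,d)$ is a finite metric space with $n=|\mathcal X|$ points. A nonempty set $F\subseteq\mathcal X$ of open facilities costs $|F|+\sum_{x\in\mathcal X}\min_{f\in F}d(x,f)$, and $\mathrm{Opt}_S$ is the minimum of this cost over all nonempty $F$. Let $G_S$ be the edge-weighted graph on $\mathcal X$ in which $x$ and $y$ are adjacent if and only if $d(x,y)\le 1$ (so every $x$ is its own neighbour), with edge weight $d(x,y)$, and let $N(x)=\{y: d(x,y)\le 1\}$. For a discretization $0=a_0<a_1<\dots<a_k=1$, consider the three-layer message-passing network $\mathsf{mpnn}_\theta$ that takes $n$ as the initial feature of every vertex and computes $$t_x^{(i)}=T\Big(\sum_{y\in N(x)}M\big(a_i,d(x,y)\big)\Big)\ (0\le i\le k),\qquad \hat r_x=\sum_{i=1}^kR\big(a_i,t_x^{(i-1)},t_x^{(i)}\big),\qquad \mathsf{mpnn}_\theta(G_S,x)=P(n,\hat r_x),$$ where $M\colon\mathbb R^2\to\mathbb R^3$ is a one-layer feed-forward network, $T,R\colon\mathbb R^3\to\mathbb R$ and $P\colon\mathbb R^2\to\mathbb R$ are two-layer feed-forward networks of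 hidden width $3$, with ReLU applied after every layer, and $\theta$ consists of the weights and biases of $M,T,R,P$ (shared by all vertices and all $i$). Given probabilities $p=(p_x)_{x\in\mathcal X}$, let $F_1$ contain each $x$ independently with probability $p_x$, and let $F_2$ be the set of all $x$ with no $f\in F_1$ such that $d(x,f)<1$. Facilities are opened at $F_1\cup F_2$, and each $x\notin F_2$ is assigned to its nearest facility in $F_1$; put $$\mathrm{cost}(\mathcal X,p)=|F_1\cup F_2|+\sum_{x\in\mathcal X\setminus F_2}\min_{f\in F_1}d(x,f).$$ **Proposition.** There are universal constants $C,c>0$ such that for every $n\ge 1$ there exist $k\in\mathbb N$, a discretization $0=a_0<a_1<\dots<a_k=1$ and a parameter assignment $\theta^*$ such that for every instance $S=(\mathcal X,d)$ with $|\mathcal X|=n$ and all $x\in\mathcal X$ the network $\mathsf{mpnn}_{\theta^*}$ on $G_S$ computes $$t_x^{(i)}=\min\Big\{1,\sum_{y\in N(x)}\max\{0,a_i-d(x,y)\}\Big\},\qquad \hat r_x=\sum_{i=1}^ka_i\big(t_x^{(i)}-t_x^{(i-1)}\big),$$ and outputs $p_x=\mathsf{mpnn}_{\theta^*}(G_S,x)=\min\{1,c\log(n)\,\hat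 r_x\}\in[0,1]$, and $$\mathbb E\big[\mathrm{cost}(\mathcal X,p)\big]\le C\,\log(\max\{n,2\})\cdot\mathrm{Opt}_S .$$ -/

import Mathlib

/-! ## Edge-weighted graphs and the graph of a metric space -/

/-- An undirected edge-weighted graph. Loops are allowed; the weight is only available on edges. -/
structure EdgeWeightedGraph (V : Type*) where
  Adj : V → V → Prop
  symm : ∀ u v, Adj u v → Adj v u
  weight : ∀ u v, Adj u v → ℝ
  weight_nonneg : ∀ u v h, 0 ≤ weight u v h
  weight_symm : ∀ u v h, weight u v h = weight v u (symm u v h)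

/-- The graph `G_S` of a metric space: `u` and `v` are joined when `d(u,v) ≤ 1` (in particular
every vertex carries a loop of weight `0`), and the weight of an edge is the distance. -/
def metricGraph (X : Type*) [PseudoMetricSpace X] : EdgeWeightedGraph X where
  Adj u v := dist u v ≤ 1
  symm u v h := by rw [dist_comm]; exact h
  weight u v _ := dist u v
  weight_nonneg _ _ _ := dist_nonneg
  weight_symm u v _ := dist_comm u v

/-! ## Message-passing layers -/

open Classical in
/-- The multiset of triples `(h v, h u, w(v,u))`, `u` ranging over the neighbours of `v`. -/
noncomputable def EdgeWeightedGraph.messages {V α : Type*} [Fintype V] (G : EdgeWeightedGraph V)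
    (h : V → α) (v : V) : Multiset (α × α × ℝ) :=
  (Finset.univ : Finset {u : V // G.Adj v u}).val.map fun u => (h v, h u.1, G.weight v u.1 u.2)

/-- A message-passing layer: it turns vertex features in `α` into vertex features in `β`. -/
structure MPNNLayer (α M β : Type*) where
  agg : Multiset (α × α × ℝ) → M
  upd : α → M → β

/-- `h'(v) = UPD(h(v), AGG {{ (h(v), h(u), w(v,u)) : u ∈ N(v) }})`. -/
noncomputable def MPNNLayer.forward {α M β V : Type*} [Fintype V] (ℓ : MPNNLayer α M β)
    (G : EdgeWeightedGraph V) (h : V → α) (v : V) : β :=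
  ℓ.upd (h v) (ℓ.agg (G.messages h v))

/-! ## Feed-forward ReLU networks -/

/-- The parameters of one layer `x ↦ ReLU(x W + b)` from `ℝ^m` to `ℝ^n`. -/
structure ReLULayer (m n : ℕ) where
  W : Matrix (Fin m) (Fin n) ℝ
  b : Fin n → ℝ

/-- Evaluation of a layer. -/
noncomputable def ReLULayer.eval {m n : ℕ} (ℓ : ReLULayer m n) (x : Fin m → ℝ) : Fin n → ℝ :=
  fun j => max 0 (Matrix.vecMul x ℓ.W j + ℓ.b j)

/-- Parameters of a feed-forward ReLU network `FNN w L m n` with hidden width `w` and `L` layers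
(ReLU is applied after every layer, also the last one), from `ℝ^m` to `ℝ^n`. -/
inductive FNN (w : ℕ) : ℕ → ℕ → ℕ → Type
  | last {m n : ℕ} (ℓ : ReLULayer m n) : FNN w 1 m n
  | cons {L m n : ℕ} (ℓ : ReLULayer m w) (N : FNN w L w n) : FNN w (L + 1) m n

/-- Evaluation of a feed-forward network. -/
noncomputable def FNN.eval {w : ℕ} : {L m n : ℕ} → FNN w L m n → (Fin m → ℝ) → (Fin n → ℝ)
  | _, _, _, .last ℓ, x => ℓ.eval x
  | _, _, _, .cons ℓ N, x => N.eval (ℓ.eval x)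

/-! ## The architecture for uniform facility location -/

/-- The trainable parameters `θ`: four feed-forward networks of depth at most two and width three.
They are shared by all vertices and all bins. -/
structure UFLParams where
  /-- applied to `(a_i, d(x,y))` on every edge -/
  msg : FNN 3 1 2 3
  /-- applied to the sum of the messages; gives `t_x^(i)` -/
  thr : FNN 3 2 3 1
  /-- applied to `(a_i, t_x^(i-1), t_x^(i))`; the sum over `i` is the radius estimate -/
  rad : FNN 3 2 3 1
  /-- applied to `(n, radius estimate)`; gives the opening probability -/
  prob : FNN 3 2 2 1

namespace UFLParams

variable {k : ℕ} {V : Type*} [Fintype V]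

/-- First layer, with sum aggregation: from the feature `n` to the feature `(n, t^(0), …, t^(k))`,
where `t_x^(i) = thr (∑_{y ∈ N(x)} msg (a_i, w(x,y)))`. -/
noncomputable def thresholdLayer (θ : UFLParams) (a : Fin (k + 1) → ℝ) :
    MPNNLayer ℝ (Fin (k + 1) → Fin 3 → ℝ) (ℝ × (Fin (k + 1) → ℝ)) where
  agg s := fun i => (s.map fun e => θ.msg.eval ![a i, e.2.2]).sum
  upd h m := (h, fun i => θ.thr.eval (m i) 0)

/-- Second layer, vertex-wise: from `(n, t)` to `(n, ∑_{i=1}^k rad (a_i, t^(i-1), t^(i)))`. -/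
noncomputable def radiusLayer (θ : UFLParams) (a : Fin (k + 1) → ℝ) :
    MPNNLayer (ℝ × (Fin (k + 1) → ℝ)) Unit (ℝ × ℝ) where
  agg _ := ()
  upd h _ := (h.1, ∑ i : Fin k, θ.rad.eval ![a i.succ, h.2 i.castSucc, h.2 i.succ] 0)

/-- Third layer, vertex-wise: from `(n, r)` to `prob (n, r)`. -/
noncomputable def probLayer (θ : UFLParams) : MPNNLayer (ℝ × ℝ) Unit ℝ where
  agg _ := ()
  upd h _ := θ.prob.eval ![h.1, h.2] 0

/-- Initial vertex features: every vertex knows the order `n` of the graph. -/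
noncomputable def initFeature (V : Type*) [Fintype V] : V → ℝ := fun _ => (Fintype.card V : ℝ)

/-- Vertex features after the first layer. -/
noncomputable def feature₁ (θ : UFLParams) (a : Fin (k + 1) → ℝ) (G : EdgeWeightedGraph V) :
    V → ℝ × (Fin (k + 1) → ℝ) :=
  (θ.thresholdLayer a).forward G (initFeature V)

/-- Vertex features after the second layer. -/
noncomputable def feature₂ (θ : UFLParams) (a : Fin (k + 1) → ℝ) (G : EdgeWeightedGraph V) :
    V → ℝ × ℝ :=
  (θ.radiusLayer a).forward G (θ.feature₁ a G)

/-- The value `t_v^(i)` computed by the network. -/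
noncomputable def threshold (θ : UFLParams) (a : Fin (k + 1) → ℝ) (G : EdgeWeightedGraph V)
    (v : V) (i : Fin (k + 1)) : ℝ :=
  (θ.feature₁ a G v).2 i

/-- The radius estimate of `v` computed by the network. -/
noncomputable def radiusEstimate (θ : UFLParams) (a : Fin (k + 1) → ℝ) (G : EdgeWeightedGraph V)
    (v : V) : ℝ :=
  (θ.feature₂ a G v).2

/-- The output `mpnn_θ(G, v)` of the three-layer network with discretization `a`. -/
noncomputable def mpnn (θ : UFLParams) (a : Fin (k + 1) → ℝ) (G : EdgeWeightedGraph V) :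
    V → ℝ :=
  θ.probLayer.forward G (θ.feature₂ a G)

end UFLParams

/-! ## Uniform facility location -/

section UniformFacilityLocation

variable {X : Type*} [Fintype X] [PseudoMetricSpace X]

/-- The cost `∑_x d(x,F) + |F|` of opening the (nonempty) set `F` of facilities. -/
noncomputable def uflObjective (F : Finset X) : ℝ :=
  ∑ x : X, Metric.infDist x (F : Set X) + (F.card : ℝ)

/-- The optimal cost, the minimum of the objective over the nonempty sets of facilities. -/
noncomputable def uflOpt (X : Type*) [Fintype X] [PseudoMetricSpace X] : ℝ :=
  ⨅ F : {F : Finset X // F.Nonempty}, uflObjective F.1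

open Classical in
/-- The facilities `F₂` opened in the post-processing: the points that have no facility of `F₁`
at distance strictly smaller than `1`. -/
noncomputable def secondFacilities (F₁ : Finset X) : Finset X :=
  Finset.univ.filter fun x => ¬ ∃ f ∈ F₁, dist x f < 1

open Classical in
/-- The opening and connection cost after the post-processing of `F₁`: all facilities of
`F₁ ∪ F₂` are paid for, points of `F₂` have connection cost `0`, and every other point is
assigned to the nearest facility of `F₁`. -/
noncomputable def postprocessCost (F₁ : Finset X) : ℝ :=
  ((F₁ ∪ secondFacilities F₁).card : ℝ) +
    ∑ x ∈ Finset.univ \ secondFacilities F₁, Metric.infDist x (F₁ : Set X)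

open Classical in
/-- The expected cost when every `x` is put into `F₁` independently with probability `p x`. -/
noncomputable def expectedCost (p : X → ℝ) : ℝ :=
  ∑ F₁ : Finset X, (∏ x : X, if x ∈ F₁ then p x else 1 - p x) * postprocessCost F₁

end UniformFacilityLocation

/-!
For a point `x` let `r_x` be the solution of `∑_y max 0 (r_x - d(x,y)) = 1` (the radius of Mettu
and Plaxton). Three facts about it carry the proof.

* `∑ r_x ≤ 2 Opt` (`sum_mpRadius_le_uflOpt`), by summing, over the facilities of a solution, the
  radii of the points assigned to one facility.
* `r` has total mass at least `1/2` on the ball of radius `2 r_x` around `x`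
  (`half_le_sum_mpRadius`). So if the points are opened with probability `min 1 (8 log n r̂)`, where
  `r̂ ≥ r / 4`, then no facility is opened in this ball with probability at most `1/n`. A point
  costs at most `2 r_x` if there is one, and at most `1` otherwise.
* On the uniform grid `a_i = i/n` the estimate `r̂_x = ∑ a_i (t_x^(i) - t_x^(i-1))` lies between
  `r_x / 4` and `2 r_x` (`le_gridRadius`, `gridRadius_le`), as `r_x ≥ 1/n`.

Hence the expected cost is at most `∑ p_x + ∑ (2 r_x + 1/n) = O(log n ∑ r_x) + 1`, and `Opt ≥ 1`
(`expectedCost_le_log_mul_uflOpt`).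

The network computes `r̂_x` exactly although ReLU networks cannot multiply: on the uniform grid,
summation by parts gives `r̂_x = ∑ (1 - t_x^(i-1)) / n`
(`uflParams_radiusEstimate_eq_gridRadius`).
-/

/-! ### The Mettu-Plaxton radius -/

section Radius

variable {X : Type*} [Fintype X] [PseudoMetricSpace X]

/-- The total amount `∑_y max 0 (r - d(x,y))` by which the ball of radius `r` around `x` exceeds
the distances of its points from `x`. -/
noncomputable def excess (x : X) (r : ℝ) : ℝ := ∑ y : X, max 0 (r - dist x y)

lemma excess_mono (x : X) : Monotone (excess x) := fun r s h =>
  Finset.sum_le_sum fun y _ => max_le_max_left 0 (by linarith)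

lemma le_excess (x : X) (r : ℝ) : r ≤ excess x r := by
  refine le_trans ?_ (Finset.single_le_sum (f := fun y => max 0 (r - dist x y))
    (fun _ _ => le_max_left _ _) (Finset.mem_univ x))
  simp

lemma excess_zero (x : X) : excess x 0 = 0 :=
  Finset.sum_eq_zero fun y _ => max_eq_left (by linarith [dist_nonneg (x := x) (y := y)])

/-- The point `x` itself contributes with slope `1` to the excess. -/
lemma excess_add_sub_le (x : X) {r s : ℝ} (hr : 0 ≤ r) (h : r ≤ s) :
    excess x r + (s - r) ≤ excess x s := by
  classical
  unfold excess
  rw [← Finset.add_sum_erase _ _ (Finset.mem_univ x),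
    ← Finset.add_sum_erase (a := x) _ (fun y => max 0 (s - dist x y)) (Finset.mem_univ x)]
  have h1 : ∑ y ∈ Finset.univ.erase x, max 0 (r - dist x y) ≤
      ∑ y ∈ Finset.univ.erase x, max 0 (s - dist x y) :=
    Finset.sum_le_sum fun y _ => max_le_max_left 0 (by linarith)
  simp only [dist_self, sub_zero, max_eq_right hr, max_eq_right (hr.trans h)]
  linarith

lemma excess_half_le (x : X) {r : ℝ} : excess x (r / 2) ≤ excess x r / 2 := by
  unfold excess
  rw [Finset.sum_div]
  refine Finset.sum_le_sum fun y _ => max_le ?_ ?_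
  · have := le_max_left 0 (r - dist x y)
    linarith
  · have := le_max_right 0 (r - dist x y)
    linarith [dist_nonneg (x := x) (y := y)]

open Classical in
lemma excess_le_mul_card (x : X) {r : ℝ} (hr : 0 ≤ r) :
    excess x r ≤ r * ({y : X | dist x y ≤ r} : Finset X).card := by
  unfold excess
  rw [mul_comm, ← nsmul_eq_mul, ← Finset.sum_const, Finset.sum_filter]
  refine Finset.sum_le_sum fun y _ => ?_
  split_ifs with h
  · exact max_le hr (by linarith [dist_nonneg (x := x) (y := y)])
  · exact max_le le_rfl (by linarith)

lemma exists_excess_eq_one (x : X) : ∃ r ∈ Set.Icc (0 : ℝ) 1, excess x r = 1 := by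
  have hc : Continuous (excess x) := by
    unfold excess
    fun_prop
  exact intermediate_value_Icc zero_le_one hc.continuousOn
    ⟨by simp [excess_zero], le_excess x 1⟩

/-- The radius `r_x` of Mettu and Plaxton, the solution of `∑_y max 0 (r_x - d(x,y)) = 1`. -/
noncomputable def mpRadius (x : X) : ℝ := (exists_excess_eq_one x).choose

lemma mpRadius_nonneg (x : X) : 0 ≤ mpRadius x := (exists_excess_eq_one x).choose_spec.1.1

lemma excess_mpRadius (x : X) : excess x (mpRadius x) = 1 :=
  (exists_excess_eq_one x).choose_spec.2

lemma mpRadius_le_of_one_le_excess (x : X) {s : ℝ} (h0 : 0 ≤ s) (h : 1 ≤ excess x s) :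
    mpRadius x ≤ s := by
  by_contra! hs
  have := excess_add_sub_le x h0 hs.le
  rw [excess_mpRadius] at this
  linarith

open Classical in
lemma one_le_mpRadius_mul_card_closedBall (x : X) :
    1 ≤ mpRadius x * ({y : X | dist x y ≤ mpRadius x} : Finset X).card :=
  (excess_mpRadius x).symm.le.trans (excess_le_mul_card x (mpRadius_nonneg x))

lemma one_le_mpRadius_mul_card (x : X) : 1 ≤ mpRadius x * Fintype.card X := by
  classical
  refine (one_le_mpRadius_mul_card_closedBall x).trans ?_
  have := mpRadius_nonneg x
  gcongr
  exact Finset.card_le_univ _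

lemma mpRadius_pos (x : X) : 0 < mpRadius x := by
  refine (mpRadius_nonneg x).lt_of_ne fun h => ?_
  have := one_le_mpRadius_mul_card x
  rw [← h] at this
  norm_num at this

lemma mpRadius_le_add_dist (x y : X) : mpRadius x ≤ mpRadius y + dist x y := by
  refine mpRadius_le_of_one_le_excess x (add_nonneg (mpRadius_nonneg y) dist_nonneg) ?_
  rw [← excess_mpRadius y]
  refine Finset.sum_le_sum fun z _ => max_le_max_left 0 ?_
  linarith [dist_triangle_left y z x, dist_triangle x y z]

open Classical in
/-- If all radii in the ball of radius `r_x` around `x` are at least `r_x / 2`, this holds because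
the ball has at least `1 / r_x` points; otherwise the ball has a point of radius below `r_x / 2`,
to which the argument is applied again. The distances travelled form a geometric series. -/
lemma half_le_sum_mpRadius (x : X) :
    1 / 2 ≤ ∑ y : X with dist x y ≤ 2 * mpRadius x, mpRadius y := by
  have wf : WellFounded fun y x : X => mpRadius y < mpRadius x :=
    (Finite.wellFounded_of_trans_of_irrefl (fun a b : Set.range (mpRadius (X := X)) => a < b)).onFun
      (f := Set.rangeFactorization mpRadius)
  induction x using wf.induction with
  | _ x ih =>
  by_cases! h : ∃ y, dist x y ≤ mpRadius x ∧ mpRadius y < mpRadius x / 2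
  · obtain ⟨y, hxy, hy⟩ := h
    refine (ih y (by linarith [mpRadius_pos x])).trans ?_
    refine Finset.sum_le_sum_of_subset_of_nonneg (fun z hz => ?_) fun z _ _ => mpRadius_nonneg z
    simp only [Finset.mem_filter, Finset.mem_univ, true_and] at hz ⊢
    linarith [dist_triangle x y z]
  · calc (1 : ℝ) / 2
        ≤ ({y : X | dist x y ≤ mpRadius x} : Finset X).card • (mpRadius x / 2) := by
          rw [nsmul_eq_mul]
          linarith [one_le_mpRadius_mul_card_closedBall x]
      _ ≤ ∑ y : X with dist x y ≤ mpRadius x, mpRadius y :=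
          Finset.card_nsmul_le_sum _ _ _ fun y hy => h y (by simpa using hy)
      _ ≤ _ := by
          refine Finset.sum_le_sum_of_subset_of_nonneg (fun z hz => ?_)
            fun z _ _ => mpRadius_nonneg z
          simp only [Finset.mem_filter, Finset.mem_univ, true_and] at hz ⊢
          linarith [mpRadius_nonneg x]

/-- The points assigned to one facility `f` have a total radius of at most `1` plus twice their
connection cost: the radius of `f` is at most the average of `1 + ∑_{x ∈ s} d(x,f)` over `s`. -/
lemma sum_mpRadius_le (s : Finset X) (f : X) :
    ∑ x ∈ s, mpRadius x ≤ 1 + 2 * ∑ x ∈ s, dist x f := by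
  have h1 : ∑ x ∈ s, (mpRadius f - dist x f) ≤ 1 := by
    rw [← excess_mpRadius f]
    refine (Finset.sum_le_sum fun x _ => ?_).trans (Finset.sum_le_sum_of_subset_of_nonneg
      (Finset.subset_univ s) fun _ _ _ => le_max_left _ _)
    rw [dist_comm]
    exact le_max_right _ _
  have h2 : ∑ x ∈ s, mpRadius x ≤ ∑ x ∈ s, (mpRadius f + dist x f) :=
    Finset.sum_le_sum fun x _ => mpRadius_le_add_dist x f
  rw [Finset.sum_sub_distrib] at h1
  rw [Finset.sum_add_distrib] at h2
  linarith

omit [Fintype X] in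
lemma exists_mem_infDist_eq_dist {F : Finset X} (hF : F.Nonempty) (x : X) :
    ∃ f ∈ F, Metric.infDist x (F : Set X) = dist x f := by
  have := F.finite_toSet.isCompact.exists_infDist_eq_dist (by simpa using hF) x
  simpa using this

lemma sum_mpRadius_le_uflObjective {F : Finset X} (hF : F.Nonempty) :
    ∑ x : X, mpRadius x ≤ 2 * uflObjective F := by
  classical
  choose φ hφF hφ using exists_mem_infDist_eq_dist hF
  have h : ∀ f ∈ F, ∑ x : X with φ x = f, mpRadius x ≤
      1 + 2 * ∑ x : X with φ x = f, Metric.infDist x (F : Set X) := fun f _ => by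
    refine (sum_mpRadius_le _ f).trans_eq ?_
    congr 2
    refine Finset.sum_congr rfl fun x hx => ?_
    rw [hφ, (Finset.mem_filter.1 hx).2]
  have := Finset.sum_le_sum h
  rw [Finset.sum_add_distrib, ← Finset.mul_sum,
    Finset.sum_fiberwise_of_maps_to fun x _ => hφF x,
    Finset.sum_fiberwise_of_maps_to fun x _ => hφF x] at this
  simp only [Finset.sum_const, nsmul_eq_mul, mul_one] at this
  unfold uflObjective
  linarith [Nat.cast_nonneg (α := ℝ) F.card]

variable [Nonempty X]

instance : Nonempty {F : Finset X // F.Nonempty} := ⟨⟨_, Finset.univ_nonempty⟩⟩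

lemma sum_mpRadius_le_uflOpt : ∑ x : X, mpRadius x ≤ 2 * uflOpt X := by
  have : (∑ x : X, mpRadius x) / 2 ≤ uflOpt X :=
    le_ciInf fun F => by linarith [sum_mpRadius_le_uflObjective F.2]
  linarith

lemma one_le_uflOpt : 1 ≤ uflOpt X := by
  refine le_ciInf fun F => ?_
  have h1 : (1 : ℝ) ≤ F.1.card := by exact_mod_cast F.2.card_pos
  have h2 : 0 ≤ ∑ x : X, Metric.infDist x (F.1 : Set X) :=
    Finset.sum_nonneg fun _ _ => Metric.infDist_nonneg
  unfold uflObjective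
  linarith

end Radius

/-! ### The discretized radius -/

section Grid

variable {X : Type*} [Fintype X] [PseudoMetricSpace X]

/-- The estimate `∑_{i < n} (i+1)/n * (t((i+1)/n) - t(i/n))` of the radius of `x` on the uniform
grid of mesh `1/n`, where `t(r) = min 1 (excess x r)`. -/
noncomputable def gridRadius (n : ℕ) (x : X) : ℝ :=
  ∑ i ∈ Finset.range n, ((i + 1 : ℕ) / n : ℝ) *
    (min 1 (excess x ((i + 1 : ℕ) / n)) - min 1 (excess x ((i : ℕ) / n)))

lemma min_one_excess_mono (x : X) (n i : ℕ) :
    min 1 (excess x ((i : ℕ) / n)) ≤ min 1 (excess x ((i + 1 : ℕ) / n)) := by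
  refine min_le_min_left 1 (excess_mono x ?_)
  gcongr
  simp

lemma sum_min_one_excess_sub (x : X) {n : ℕ} (hn : 0 < n) :
    ∑ i ∈ Finset.range n, (min 1 (excess x ((i + 1 : ℕ) / n)) - min 1 (excess x ((i : ℕ) / n)))
      = 1 := by
  have hn' : (n : ℝ) ≠ 0 := by positivity
  rw [Finset.sum_range_sub fun i : ℕ => min 1 (excess x ((i : ℕ) / n))]
  simp [div_self hn', excess_zero, le_excess]

/-- Only the grid points below `r_x` contribute, and the next one is at most `r_x + 1/n`. -/
lemma gridRadius_le {n : ℕ} (hn : Fintype.card X = n) (x : X) :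
    gridRadius n x ≤ 2 * mpRadius x := by
  have hpos : 0 < n := hn ▸ Fintype.card_pos_iff.2 ⟨x⟩
  have hn' : (0 : ℝ) < n := by exact_mod_cast hpos
  rw [← mul_one (2 * mpRadius x), ← sum_min_one_excess_sub x hpos, Finset.mul_sum, gridRadius]
  refine Finset.sum_le_sum fun i _ => ?_
  have hmono := min_one_excess_mono x n i
  rcases le_or_gt (mpRadius x) (i / n) with h | h
  · have h1 : 1 ≤ excess x ((i : ℕ) / n) := (excess_mpRadius x).symm.le.trans (excess_mono x h)
    rw [min_eq_left h1] at hmono ⊢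
    rw [le_antisymm (min_le_left _ _) hmono]
    simp
  · refine mul_le_mul_of_nonneg_right ?_ (sub_nonneg.2 hmono)
    have h1 : 1 / (n : ℝ) ≤ mpRadius x := by
      rw [div_le_iff₀ hn', ← hn]
      exact one_le_mpRadius_mul_card x
    push_cast
    rw [add_div]
    linarith

/-- By convexity at least half of the increase of `t` from `0` to `1` happens above `r_x / 2`. -/
lemma le_gridRadius {n : ℕ} (hn : 0 < n) (x : X) : mpRadius x / 4 ≤ gridRadius n x := by
  set t : ℕ → ℝ := fun i => min 1 (excess x ((i : ℕ) / n)) with ht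
  have hn' : (n : ℝ) ≠ 0 := by positivity
  have h : ∑ i ∈ Finset.range n, mpRadius x / 2 * (max (1 / 2) (t (i + 1)) - max (1 / 2) (t i)) =
      mpRadius x / 4 := by
    rw [← Finset.mul_sum, Finset.sum_range_sub fun i => max (1 / 2) (t i)]
    have h0 : t 0 = 0 := by simp [ht, excess_zero]
    have h1 : t n = 1 := by simp [ht, div_self hn', le_excess]
    rw [h0, h1]
    norm_num
    ring
  rw [← h, gridRadius]
  refine Finset.sum_le_sum fun i _ => ?_
  have hmono : t i ≤ t (i + 1) := min_one_excess_mono x n i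
  have hr := mpRadius_nonneg x
  change _ ≤ ((i + 1 : ℕ) / n : ℝ) * (t (i + 1) - t i)
  rcases le_or_gt (((i + 1 : ℕ) : ℝ) / n) (mpRadius x / 2) with h | h
  · have h1 : t (i + 1) ≤ 1 / 2 := by
      refine (min_le_right _ _).trans ((excess_mono x h).trans ?_)
      rw [← excess_mpRadius x]
      exact excess_half_le x
    rw [max_eq_left h1, max_eq_left (hmono.trans h1), sub_self, mul_zero]
    exact mul_nonneg (by positivity) (sub_nonneg.2 hmono)
  · refine mul_le_mul h.le ?_ (sub_nonneg.2 (max_le_max_left _ hmono)) (by positivity)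
    rcases max_cases (1 / 2) (t (i + 1)) with h1 | h1 <;>
      rcases max_cases (1 / 2) (t i) with h2 | h2 <;> linarith

end Grid

/-! ### Independent sampling and the expected cost -/

section Sampling

variable {X : Type*} [Fintype X]

open Classical in
/-- The probability that the random set, which contains each `x` independently with probability
`p x`, equals `F`. -/
noncomputable def samplingWeight (p : X → ℝ) (F : Finset X) : ℝ :=
  ∏ x : X, if x ∈ F then p x else 1 - p x

open Classical in
lemma sum_prod_ite_mem (f g : X → ℝ) :
    ∑ F : Finset X, ∏ x : X, (if x ∈ F then f x else g x) = ∏ x : X, (f x + g x) := by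
  rw [Fintype.prod_add]
  refine Finset.sum_congr rfl fun F _ => ?_
  rw [Finset.prod_ite]
  congr 2 <;> ext x <;> simp

lemma samplingWeight_nonneg {p : X → ℝ} (hp : ∀ x, p x ∈ Set.Icc (0 : ℝ) 1) (F : Finset X) :
    0 ≤ samplingWeight p F :=
  Finset.prod_nonneg fun x _ => by
    split_ifs
    · exact (hp x).1
    · exact sub_nonneg.2 (hp x).2

lemma sum_samplingWeight (p : X → ℝ) : ∑ F : Finset X, samplingWeight p F = 1 := by
  unfold samplingWeight
  rw [sum_prod_ite_mem]
  simp

open Classical in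
/-- The probability that the random set misses `s`. -/
lemma sum_samplingWeight_disjoint (p : X → ℝ) (s : Finset X) :
    ∑ F : Finset X, samplingWeight p F * (if Disjoint F s then 1 else 0) =
      ∏ x ∈ s, (1 - p x) := by
  have h : ∀ F : Finset X, samplingWeight p F * (if Disjoint F s then 1 else 0) =
      ∏ x : X, if x ∈ F then (if x ∈ s then 0 else p x) else 1 - p x := fun F => by
    split_ifs with hd
    · rw [mul_one]
      refine Finset.prod_congr rfl fun x _ => ?_
      by_cases hx : x ∈ F
      · simp [hx, Finset.disjoint_left.1 hd hx]
      · simp [hx]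
    · obtain ⟨x, hxF, hxs⟩ := Finset.not_disjoint_iff.1 hd
      rw [mul_zero, Finset.prod_eq_zero (Finset.mem_univ x)]
      simp [hxF, hxs]
  simp_rw [h]
  rw [sum_prod_ite_mem, ← Finset.prod_subset (Finset.subset_univ s)]
  · exact Finset.prod_congr rfl fun x hx => by simp [hx]
  · intro x _ hx
    simp [hx]

lemma sum_samplingWeight_mul_card (p : X → ℝ) :
    ∑ F : Finset X, samplingWeight p F * (F.card : ℝ) = ∑ x : X, p x := by
  classical
  have h : ∀ F : Finset X, samplingWeight p F * (F.card : ℝ) =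
      ∑ x : X, (samplingWeight p F - samplingWeight p F *
        (if Disjoint F {x} then 1 else 0)) := fun F => by
    have hF : (F.card : ℝ) = ∑ x : X, (1 - if Disjoint F {x} then (1 : ℝ) else 0) := by
      have h1 : ∀ x : X, (1 - if Disjoint F {x} then (1 : ℝ) else 0) =
          if x ∈ F then 1 else 0 := fun x => by
        by_cases hx : x ∈ F <;> simp [hx]
      simp_rw [h1]
      simp
    rw [hF, Finset.mul_sum]
    exact Finset.sum_congr rfl fun x _ => by ring
  simp_rw [h]
  rw [Finset.sum_comm]
  refine Finset.sum_congr rfl fun x _ => ?_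
  rw [Finset.sum_sub_distrib, sum_samplingWeight, sum_samplingWeight_disjoint]
  simp

variable [PseudoMetricSpace X]

open Classical in
/-- A point with a facility of `F` at distance at most `ρ` pays at most `ρ` (if that facility is
at distance `≥ 1` and the point is opened itself, then `1 ≤ ρ`); any point pays at most `1`. -/
lemma postprocessCost_le (F : Finset X) {ρ : X → ℝ} (hρ : ∀ x, 0 ≤ ρ x) :
    postprocessCost F ≤ F.card + ∑ x : X, (ρ x +
      if Disjoint F ({y : X | dist x y ≤ ρ x} : Finset X) then 1 else 0) := by
  have h1 : ((F ∪ secondFacilities F).card : ℝ) ≤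
      F.card + ∑ x ∈ secondFacilities F, (1 : ℝ) := by
    simpa using (Nat.cast_le (α := ℝ)).2 (Finset.card_union_le F (secondFacilities F))
  have h2 : ∑ x ∈ secondFacilities F, (1 : ℝ) ≤ ∑ x ∈ secondFacilities F, (ρ x +
      if Disjoint F ({y : X | dist x y ≤ ρ x} : Finset X) then 1 else 0) := by
    refine Finset.sum_le_sum fun x hx => ?_
    split_ifs with hd
    · linarith [hρ x]
    · obtain ⟨f, hf, hfx⟩ := Finset.not_disjoint_iff.1 hd
      simp only [secondFacilities, Finset.mem_filter, Finset.mem_univ, true_and] at hx hfx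
      push Not at hx
      linarith [hx f hf]
  have h3 : ∑ x ∈ Finset.univ \ secondFacilities F, Metric.infDist x (F : Set X) ≤
      ∑ x ∈ Finset.univ \ secondFacilities F, (ρ x +
      if Disjoint F ({y : X | dist x y ≤ ρ x} : Finset X) then 1 else 0) := by
    refine Finset.sum_le_sum fun x hx => ?_
    split_ifs with hd
    · obtain ⟨f, hf, hfx⟩ : ∃ f ∈ F, dist x f < 1 := by
        simpa [secondFacilities] using hx
      linarith [hρ x, Metric.infDist_le_dist_of_mem (x := x) (Finset.mem_coe.2 hf)]
    · obtain ⟨f, hf, hfx⟩ := Finset.not_disjoint_iff.1 hd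
      simp only [Finset.mem_filter, Finset.mem_univ, true_and] at hfx
      linarith [Metric.infDist_le_dist_of_mem (x := x) (Finset.mem_coe.2 hf)]
  rw [← Finset.sum_sdiff (Finset.subset_univ (secondFacilities F))]
  unfold postprocessCost
  linarith

open Classical in
lemma expectedCost_le {p ρ : X → ℝ} (hp : ∀ x, p x ∈ Set.Icc (0 : ℝ) 1) (hρ : ∀ x, 0 ≤ ρ x) :
    expectedCost p ≤
      ∑ x : X, p x + ∑ x : X, (ρ x + ∏ y : X with dist x y ≤ ρ x, (1 - p y)) := by
  calc expectedCost p = ∑ F : Finset X, samplingWeight p F * postprocessCost F := rfl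
    _ ≤ ∑ F : Finset X, samplingWeight p F * (F.card + ∑ x : X, (ρ x +
          if Disjoint F ({y : X | dist x y ≤ ρ x} : Finset X) then 1 else 0)) :=
        Finset.sum_le_sum fun F _ =>
          mul_le_mul_of_nonneg_left (postprocessCost_le F hρ) (samplingWeight_nonneg hp F)
    _ = _ := by
        simp_rw [mul_add, Finset.mul_sum, Finset.sum_add_distrib, mul_add,
          Finset.sum_add_distrib, sum_samplingWeight_mul_card]
        congr 2
        · rw [Finset.sum_comm]
          simp_rw [← Finset.sum_mul, sum_samplingWeight, one_mul]
        · rw [Finset.sum_comm]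
          simp_rw [sum_samplingWeight_disjoint]

lemma one_sub_min_one_le_exp (q : ℝ) : 1 - min 1 q ≤ Real.exp (-q) := by
  rcases le_total 1 q with h | h
  · rw [min_eq_left h, sub_self]
    exact (Real.exp_pos _).le
  · rw [min_eq_right h]
    linarith [Real.add_one_le_exp (-q)]

/-- The expected cost is within a factor `O(log n)` of the optimum as soon as the opening
probabilities are proportional to `log n` times a constant-factor estimate of the radius. The
constant `8` makes the probability that no facility is opened within distance `2 r_x` of `x` at
most `1 / n`. -/
lemma expectedCost_le_log_mul_uflOpt [Nonempty X] {n : ℕ} (hn : Fintype.card X = n)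
    {p r : X → ℝ} (hp : ∀ x, p x = min 1 (8 * Real.log n * r x))
    (hr₁ : ∀ x, mpRadius x / 4 ≤ r x) (hr₂ : ∀ x, r x ≤ 2 * mpRadius x) :
    expectedCost p ≤ 42 * Real.log (max (n : ℝ) 2) * uflOpt X := by
  classical
  have hn1 : (1 : ℝ) ≤ n := by
    rw [← hn]
    exact_mod_cast Fintype.card_pos (α := X)
  have hlog : 0 ≤ Real.log n := Real.log_nonneg hn1
  have hr₀ : ∀ x, 0 ≤ r x := fun x => by linarith [hr₁ x, mpRadius_nonneg x]
  have hp01 : ∀ x, p x ∈ Set.Icc (0 : ℝ) 1 := fun x => by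
    rw [hp]
    exact ⟨le_min zero_le_one (mul_nonneg (by positivity) (hr₀ x)), min_le_left _ _⟩
  have hsum : ∑ x : X, p x ≤ 16 * Real.log n * ∑ x : X, mpRadius x := by
    rw [Finset.mul_sum]
    refine Finset.sum_le_sum fun x _ => ?_
    rw [hp]
    refine (min_le_right _ _).trans ?_
    nlinarith [mul_le_mul_of_nonneg_left (hr₂ x) hlog]
  have hmiss : ∀ x : X, ∏ y : X with dist x y ≤ 2 * mpRadius x, (1 - p y) ≤ 1 / n := fun x => by
    have hS : Real.log n ≤
        ∑ y : X with dist x y ≤ 2 * mpRadius x, 8 * Real.log n * r y := by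
      have h1 : 1 / 8 ≤ ∑ y : X with dist x y ≤ 2 * mpRadius x, r y := by
        have h2 := Finset.sum_le_sum (s := {y : X | dist x y ≤ 2 * mpRadius x}) fun y _ => hr₁ y
        rw [← Finset.sum_div] at h2
        linarith [half_le_sum_mpRadius x]
      rw [← Finset.mul_sum]
      nlinarith [mul_le_mul_of_nonneg_left h1 hlog]
    calc ∏ y : X with dist x y ≤ 2 * mpRadius x, (1 - p y)
        ≤ ∏ y : X with dist x y ≤ 2 * mpRadius x, Real.exp (-(8 * Real.log n * r y)) :=
          Finset.prod_le_prod (fun y _ => sub_nonneg.2 (hp01 y).2) fun y _ => by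
            rw [hp]
            exact one_sub_min_one_le_exp _
      _ = Real.exp (-∑ y : X with dist x y ≤ 2 * mpRadius x, 8 * Real.log n * r y) := by
          rw [← Real.exp_sum, Finset.sum_neg_distrib]
      _ ≤ Real.exp (-Real.log n) := Real.exp_le_exp.2 (neg_le_neg hS)
      _ = 1 / n := by rw [Real.exp_neg, Real.exp_log (by linarith), one_div]
  have hρ : ∑ x : X, (2 * mpRadius x +
      ∏ y : X with dist x y ≤ 2 * mpRadius x, (1 - p y)) ≤ 2 * ∑ x : X, mpRadius x + 1 := by
    rw [Finset.sum_add_distrib, ← Finset.mul_sum]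
    have h := Finset.sum_le_sum fun x (_ : x ∈ Finset.univ) => hmiss x
    rw [Finset.sum_const, Finset.card_univ, hn, nsmul_eq_mul, mul_one_div_cancel (by linarith)]
      at h
    linarith
  have hL : Real.log n ≤ Real.log (max (n : ℝ) 2) :=
    Real.log_le_log (by linarith) (le_max_left _ _)
  have hL2 : 1 / 2 ≤ Real.log (max (n : ℝ) 2) :=
    (by linarith [Real.log_two_gt_d9] : 1 / 2 ≤ Real.log 2).trans
      (Real.log_le_log two_pos (le_max_right _ _))
  have hO := one_le_uflOpt (X := X)
  have hR := sum_mpRadius_le_uflOpt (X := X)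
  have h1 : Real.log n * ∑ x : X, mpRadius x ≤ Real.log (max (n : ℝ) 2) * (2 * uflOpt X) :=
    mul_le_mul hL hR (Finset.sum_nonneg fun x _ => mpRadius_nonneg x) (by linarith)
  have h2 : 1 / 2 * uflOpt X ≤ Real.log (max (n : ℝ) 2) * uflOpt X :=
    mul_le_mul_of_nonneg_right hL2 (by linarith)
  linarith [expectedCost_le hp01 fun x => mul_nonneg zero_le_two (mpRadius_nonneg x)]

end Sampling

/-! ### The parameters of the network -/

/-- The parameters `θ*` for the uniform grid with `n` bins. The networks compute
`(a, d) ↦ (max 0 (a - d), 0, 0)`, `s ↦ max 0 (max 0 s₀ - max 0 (s₀ - 1))`,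
`(a, t', t) ↦ max 0 (max 0 (1 - t') / n)`, and `(m, r) ↦ max 0 (max 0 q - max 0 (q - 1))` for
`q = 8 * log n * r`; for `s₀, q ≥ 0` the second and the fourth value are `min 1 s₀` and `min 1 q`. -/
noncomputable def uflParams (n : ℕ) : UFLParams where
  msg := .last ⟨!![1, 0, 0; -1, 0, 0], 0⟩
  thr := .cons ⟨!![1, 1, 0; 0, 0, 0; 0, 0, 0], ![0, -1, 0]⟩ (.last ⟨!![1; -1; 0], 0⟩)
  rad := .cons ⟨!![0, 0, 0; -1, 0, 0; 0, 0, 0], ![1, 0, 0]⟩ (.last ⟨!![1 / (n : ℝ); 0; 0], 0⟩)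
  prob := .cons ⟨!![0, 0, 0; 8 * Real.log n, 8 * Real.log n, 0], ![0, -1, 0]⟩
    (.last ⟨!![1; -1; 0], 0⟩)

section Network

variable (n : ℕ)

lemma max_zero_max_sub_max {s : ℝ} (hs : 0 ≤ s) :
    max 0 (max 0 s - max 0 (s - 1)) = min 1 s := by
  rw [max_eq_right hs]
  rcases le_total s 1 with h | h
  · rw [max_eq_left (by linarith : s - 1 ≤ 0), min_eq_right h, sub_zero, max_eq_right hs]
  · rw [max_eq_right (by linarith : 0 ≤ s - 1), min_eq_left h]
    norm_num

lemma uflParams_msg_eval (a d : ℝ) :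
    (uflParams n).msg.eval ![a, d] = ![max 0 (a - d), 0, 0] := by
  ext j
  fin_cases j <;>
    simp [uflParams, FNN.eval, ReLULayer.eval, Matrix.vecMul, dotProduct, Fin.sum_univ_succ,
      sub_eq_add_neg]

lemma uflParams_thr_eval (s : Fin 3 → ℝ) (hs : 0 ≤ s 0) :
    (uflParams n).thr.eval s 0 = min 1 (s 0) := by
  rw [← max_zero_max_sub_max hs]
  simp [uflParams, FNN.eval, ReLULayer.eval, Matrix.vecMul, dotProduct, Fin.sum_univ_succ,
    sub_eq_add_neg]

lemma uflParams_rad_eval (a t t' : ℝ) (ht : t ≤ 1) :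
    (uflParams n).rad.eval ![a, t, t'] 0 = (1 - t) / n := by
  have h1 : 0 ≤ -t + 1 := by linarith
  have h2 : 0 ≤ (-t + 1) * (n : ℝ)⁻¹ := by positivity
  simp [uflParams, FNN.eval, ReLULayer.eval, Matrix.vecMul, dotProduct, Fin.sum_univ_succ,
    max_eq_right h1, max_eq_right h2]
  ring

lemma uflParams_prob_eval {m r : ℝ} (hr : 0 ≤ 8 * Real.log n * r) :
    (uflParams n).prob.eval ![m, r] 0 = min 1 (8 * Real.log n * r) := by
  rw [← max_zero_max_sub_max hr]
  simp [uflParams, FNN.eval, ReLULayer.eval, Matrix.vecMul, dotProduct, Fin.sum_univ_succ,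
    sub_eq_add_neg, mul_comm r]

variable {X : Type*} [Fintype X] [PseudoMetricSpace X] {k : ℕ} (a : Fin (k + 1) → ℝ)

lemma sum_neighbors_eq_excess (v : X) {r : ℝ} (hr : r ≤ 1) :
    ∑ y : X with dist v y ≤ 1, max 0 (r - dist v y) = excess v r := by
  refine Finset.sum_subset (Finset.subset_univ _) fun y _ hy => max_eq_left ?_
  simp only [Finset.mem_filter, Finset.mem_univ, true_and] at hy
  linarith

lemma uflParams_threshold_eq_min_sum (v : X) (i : Fin (k + 1)) :
    (uflParams n).threshold a (metricGraph X) v i =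
      min 1 (∑ y : X with dist v y ≤ 1, max 0 (a i - dist v y)) := by
  classical
  have key : ((((metricGraph X).messages (UFLParams.initFeature X) v).map fun e =>
      (uflParams n).msg.eval ![a i, e.2.2]).sum) 0 =
      ∑ y : X with dist v y ≤ 1, max 0 (a i - dist v y) := by
    simp only [EdgeWeightedGraph.messages, Multiset.map_map, Function.comp_def]
    change (∑ u : {u : X // (metricGraph X).Adj v u},
      (uflParams n).msg.eval ![a i, dist v u.1]) 0 = _
    rw [Finset.sum_apply]
    simp only [uflParams_msg_eval, Matrix.cons_val_zero]
    exact (Finset.sum_subtype (p := fun u => (metricGraph X).Adj v u)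
      (Finset.univ.filter fun y => dist v y ≤ 1) (fun y => by simp [metricGraph])
      fun y => max 0 (a i - dist v y)).symm
  change (uflParams n).thr.eval (Multiset.sum _) 0 = _
  rw [uflParams_thr_eval, key]
  rw [key]
  exact Finset.sum_nonneg fun _ _ => le_max_left _ _

lemma uflParams_threshold_eq_min_excess (v : X) {i : Fin (k + 1)} (hi : a i ≤ 1) :
    (uflParams n).threshold a (metricGraph X) v i = min 1 (excess v (a i)) := by
  rw [uflParams_threshold_eq_min_sum, sum_neighbors_eq_excess v hi]

lemma sum_range_succ_mul_sub (t : ℕ → ℝ) (m : ℕ) :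
    ∑ i ∈ Finset.range m, ((i + 1 : ℕ) : ℝ) * (t (i + 1) - t i) =
      m * t m - ∑ i ∈ Finset.range m, t i := by
  induction m with
  | zero => simp
  | succ m ih =>
    rw [Finset.sum_range_succ, ih, Finset.sum_range_succ]
    push_cast
    ring

/-- The network for `R` does not multiply `a_i` with `t_x^(i) - t_x^(i-1)`. Summation by parts on
the uniform grid, with `t_x^(n) = 1`, turns `∑ a_i (t_x^(i) - t_x^(i-1))` into
`∑ (1 - t_x^(i-1)) / n`, whose terms are computable by ReLU layers. -/
lemma uflParams_radiusEstimate_eq_gridRadius {n : ℕ} (hn : 0 < n) (v : X) :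
    (uflParams n).radiusEstimate (fun i : Fin (n + 1) => (i : ℝ) / n) (metricGraph X) v =
      gridRadius n v := by
  have hn' : (n : ℝ) ≠ 0 := by positivity
  set a : Fin (n + 1) → ℝ := fun i => (i : ℝ) / n with ha
  set t : ℕ → ℝ := fun i => min 1 (excess v ((i : ℕ) / n)) with ht
  have hat : ∀ i, (uflParams n).threshold a (metricGraph X) v i = t i := fun i =>
    uflParams_threshold_eq_min_excess n a v
      (div_le_one_of_le₀ (by exact_mod_cast i.is_le) (Nat.cast_nonneg n))
  have hone : t n = 1 := by simp [ht, div_self hn', le_excess]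
  calc (uflParams n).radiusEstimate a (metricGraph X) v
      = ∑ i : Fin n, (uflParams n).rad.eval ![a i.succ,
          (uflParams n).threshold a (metricGraph X) v i.castSucc,
          (uflParams n).threshold a (metricGraph X) v i.succ] 0 := rfl
    _ = ∑ i : Fin n, (1 - t i) / n := by
        refine Finset.sum_congr rfl fun i _ => ?_
        rw [hat, hat, uflParams_rad_eval _ _ _ _ (min_le_left _ _), Fin.val_castSucc]
    _ = ∑ i ∈ Finset.range n, (1 - t i) / n := Fin.sum_univ_eq_sum_range (fun i => (1 - t i) / n) n
    _ = (∑ i ∈ Finset.range n, ((i + 1 : ℕ) : ℝ) * (t (i + 1) - t i)) / n := by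
        rw [sum_range_succ_mul_sub, hone, ← Finset.sum_div, Finset.sum_sub_distrib]
        simp
    _ = gridRadius n v := by
        rw [gridRadius, Finset.sum_div]
        exact Finset.sum_congr rfl fun i _ => by rw [mul_div_right_comm]

lemma uflParams_mpnn_eq (hn : 0 < n) (v : X) :
    (uflParams n).mpnn (fun i : Fin (n + 1) => (i : ℝ) / n) (metricGraph X) v =
      min 1 (8 * Real.log n * gridRadius n v) := by
  have hr : 0 ≤ gridRadius n v := by linarith [le_gridRadius hn v, mpRadius_nonneg v]
  have hlog : 0 ≤ Real.log n := Real.log_natCast_nonneg n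
  rw [← uflParams_radiusEstimate_eq_gridRadius hn] at hr ⊢
  exact uflParams_prob_eval n (by positivity)

end Network

/-! ### The approximation guarantee of the network -/

theorem proposition2 :
    ∃ C c : ℝ, 0 < C ∧ 0 < c ∧
      ∀ n : ℕ, 1 ≤ n →
        ∃ (k : ℕ) (a : Fin (k + 1) → ℝ) (θ : UFLParams),
          StrictMono a ∧ a 0 = 0 ∧ a (Fin.last k) = 1 ∧
          ∀ (X : Type*) [Fintype X] [MetricSpace X], Fintype.card X = n →
            -- the features computed by the network
            (∀ (v : X) (i : Fin (k + 1)),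
              θ.threshold a (metricGraph X) v i =
                min 1 (∑ y : X with dist v y ≤ 1, max 0 (a i - dist v y))) ∧
            (∀ v : X,
              θ.radiusEstimate a (metricGraph X) v =
                ∑ i : Fin k, a i.succ *
                  (θ.threshold a (metricGraph X) v i.succ -
                    θ.threshold a (metricGraph X) v i.castSucc)) ∧
            (∀ v : X,
              θ.mpnn a (metricGraph X) v =
                min 1 (c * Real.log n * θ.radiusEstimate a (metricGraph X) v)) ∧
            -- the outputs are probabilities, and the expected cost is within `O(log n)` of optimal
            (∀ v : X, θ.mpnn a (metricGraph X) v ∈ Set.Icc (0 : ℝ) 1) ∧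
            expectedCost (θ.mpnn a (metricGraph X)) ≤
              C * Real.log (max (n : ℝ) 2) * uflOpt X := by
  refine ⟨42, 8, by norm_num, by norm_num, fun n hn =>
    ⟨n, fun i => (i : ℝ) / n, uflParams n, fun i j hij => ?_, by simp, ?_, ?_⟩⟩
  · exact div_lt_div_of_pos_right (by exact_mod_cast hij) (by exact_mod_cast hn)
  · have hn' : (n : ℝ) ≠ 0 := by positivity
    simp [div_self hn']
  intro X _ _ hX
  have : Nonempty X := Fintype.card_pos_iff.1 (hX ▸ hn)
  have hmpnn : ∀ v : X, (uflParams n).mpnn (fun i : Fin (n + 1) => (i : ℝ) / n) (metricGraph X) v =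
      min 1 (8 * Real.log n * gridRadius n v) := uflParams_mpnn_eq n hn
  refine ⟨uflParams_threshold_eq_min_sum n _, fun v => ?_, fun v => ?_, fun v => ?_, ?_⟩
  · rw [uflParams_radiusEstimate_eq_gridRadius hn, gridRadius, ← Fin.sum_univ_eq_sum_range
      fun i => ((i + 1 : ℕ) / n : ℝ) *
        (min 1 (excess v ((i + 1 : ℕ) / n)) - min 1 (excess v ((i : ℕ) / n)))]
    refine Finset.sum_congr rfl fun i _ => ?_
    have ha : ∀ i : Fin (n + 1), (i : ℝ) / n ≤ 1 := fun i =>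
      div_le_one_of_le₀ (by exact_mod_cast i.is_le) (Nat.cast_nonneg n)
    rw [uflParams_threshold_eq_min_excess n _ v (ha _),
      uflParams_threshold_eq_min_excess n _ v (ha _)]
    simp only [Fin.val_succ, Fin.val_castSucc]
  · rw [hmpnn, uflParams_radiusEstimate_eq_gridRadius hn]
  · have hr : 0 ≤ gridRadius n v := by linarith [le_gridRadius hn v, mpRadius_nonneg v]
    have hlog : 0 ≤ Real.log n := Real.log_natCast_nonneg n
    rw [hmpnn]
    exact ⟨le_min zero_le_one (by positivity), min_le_left _ _⟩
  · exact expectedCost_le_log_mul_uflOpt hX hmpnn (le_gridRadius hn) (gridRadius_le hX)
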